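/- Let $X$ be a dendrite, i.e. a nonempty, compact, connected, locally connected metric space that does not contain a simple closed curve (a subspace homeomorphic to the unit circle $S^1$). Let $f\colon X\to X$ be a continuous surjection, and let $\mathrm{Per}(f)=\{x\in X : f^k(x)=x \text{ for some integer } k\ge 1\}$ be its set of periodic points, where $f^k$ is the $k$-th iterate of $f$. If $\mathrm{Per}(f)$ is connected and dense in $X$, then $f$ is a homeomorphism. -/

import Mathlib

/-- A continuum: a nonempty, compact, connected metric space. -/
structure IsContinuum (X : Type*) [MetricSpace X] : Prop where
  nonempty : Nonempty X
  compact : CompactSpace X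
  connected : ConnectedSpace X

/-- A subset of a topological space is a simple closed curve if, with the subspace topology,
it is homeomorphic to the unit circle of the complex plane. -/
def IsSimpleClosedCurve {X : Type*} [TopologicalSpace X] (C : Set X) : Prop :=
  Nonempty (C ≃ₜ Circle)

/-- A dendrite: a locally connected continuum that contains no simple closed curve. -/
structure IsDendrite (X : Type*) [MetricSpace X] : Prop where
  continuum : IsContinuum X
  locallyConnected : LocallyConnectedSpace X
  no_simpleClosedCurve : ∀ C : Set X, ¬ IsSimpleClosedCurve C

/-! Only injectivity needs work, since `X` is compact Hausdorff. Suppose `f x = f y` with `x ≠ y`,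
and join them by an arc. A connected dense set `P` contains every interior point `p` of an arc
(`arc_mem_of_dense_isPreconnected`): otherwise each component of `X \ {p}` is open, meets `P`, hence
contains `P`, so there is only one. An arc inside it joining the two endpoints avoids `p` and
creates a simple closed curve. Taking `P = Per(f)`, on which every map is injective, `f` is
injective on the interior of the arc. Its equal values at the ends then close up a simple closed
curve in the image (`ne_endpoints_of_injOn_Ioo`). Two classical facts support this: complete locally
connected metric spaces are locally path connected, and points joined by a path are joined by an arc
(`JoinedIn.exists_arc`). -/

open Set Filter Topology unitInterval

/-! ### Discontinuous approximations to paths -/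

/-- `StepPath ε S a b g`: the interval `[a, b]` splits into finitely many subintervals, each of
which `g` maps into a connected open subset of `S` of diameter at most `ε`. -/
inductive StepPath {X : Type*} [MetricSpace X] (ε : ℝ) (S : Set X) : ℝ → ℝ → (ℝ → X) → Prop
  | base {a b : ℝ} {g : ℝ → X} (hab : a < b) (C : Set X) (hCS : C ⊆ S) (hC : IsOpen C)
      (hconn : IsPreconnected C) (hdiam : ∀ x ∈ C, ∀ y ∈ C, dist x y ≤ ε)
      (hg : ∀ t ∈ Icc a b, g t ∈ C) : StepPath ε S a b g
  | concat {a b c : ℝ} {g : ℝ → X} (h₁ : StepPath ε S a b g) (h₂ : StepPath ε S b c g) :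
      StepPath ε S a c g

namespace StepPath

variable {X : Type*} [MetricSpace X] {ε ε' : ℝ} {S T : Set X} {a b c : ℝ} {g g' : ℝ → X}

theorem lt (h : StepPath ε S a b g) : a < b := by
  induction h with
  | base hab => exact hab
  | concat _ _ h₁ h₂ => exact h₁.trans h₂

theorem mem (h : StepPath ε S a b g) : ∀ t ∈ Icc a b, g t ∈ S := by
  induction h with
  | base hab C hCS _ _ _ hg => exact fun t ht => hCS (hg t ht)
  | @concat a b c g _ _ h₁ h₂ =>
    intro t ht
    rcases le_total t b with h | h
    · exact h₁ t ⟨ht.1, h⟩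
    · exact h₂ t ⟨h, ht.2⟩

theorem congr (h : StepPath ε S a b g) (hg : EqOn g g' (Icc a b)) : StepPath ε S a b g' := by
  induction h with
  | base hab C hCS hC hconn hdiam hgC =>
    exact base hab C hCS hC hconn hdiam fun t ht => hg ht ▸ hgC t ht
  | concat h₁ h₂ ih₁ ih₂ =>
    exact concat (ih₁ (hg.mono (Icc_subset_Icc_right h₂.lt.le)))
      (ih₂ (hg.mono (Icc_subset_Icc_left h₁.lt.le)))

theorem mono (h : StepPath ε S a b g) (hST : S ⊆ T) : StepPath ε T a b g := by
  induction h with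
  | base hab C hCS hC hconn hdiam hg => exact base hab C (hCS.trans hST) hC hconn hdiam hg
  | concat _ _ ih₁ ih₂ => exact concat ih₁ ih₂

theorem concat_ite (h₁ : StepPath ε S a b g) (h₂ : StepPath ε S b c g') (hb : g b = g' b) :
    StepPath ε S a c (fun t => if t ≤ b then g t else g' t) := by
  refine concat (h₁.congr fun t ht => ?_) (h₂.congr fun t ht => ?_)
  · simp [ht.2]
  · rcases ht.1.eq_or_lt with rfl | h
    · simp [hb]
    · simp [h]

/-- A step path has small oscillation around every point. -/
theorem eventually_dist_le (h : StepPath ε S a b g) :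
    ∀ t ∈ Icc a b, ∀ᶠ s in 𝓝[Icc a b] t, dist (g s) (g t) ≤ ε := by
  induction h with
  | base hab C _ _ _ hdiam hg =>
    intro t ht
    filter_upwards [self_mem_nhdsWithin] with s hs
    exact hdiam _ (hg s hs) _ (hg t ht)
  | @concat a b c g h₁ h₂ ih₁ ih₂ =>
    intro t ht
    rw [← Icc_union_Icc_eq_Icc h₁.lt.le h₂.lt.le, nhdsWithin_union, eventually_sup]
    constructor
    · by_cases h : t ≤ b
      · exact ih₁ t ⟨ht.1, h⟩
      · have : 𝓝[Icc a b] t = ⊥ := by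
          rw [← notMem_closure_iff_nhdsWithin_eq_bot, isClosed_Icc.closure_eq]
          exact fun h' => h h'.2
        simp [this]
    · by_cases h : b ≤ t
      · exact ih₂ t ⟨h, ht.2⟩
      · have : 𝓝[Icc b c] t = ⊥ := by
          rw [← notMem_closure_iff_nhdsWithin_eq_bot, isClosed_Icc.closure_eq]
          exact fun h' => h h'.1
        simp [this]

/-- Nearby points share a small connected open set, and concatenation gives transitivity, so
connectedness of `C` spreads the relation to all pairs. -/
theorem exists_of_isPreconnected [LocallyConnectedSpace X] (hε : 0 < ε) {C : Set X}
    (hC : IsOpen C) (hconn : IsPreconnected C) {x y : X} (hx : x ∈ C) (hy : y ∈ C) :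
    ∀ a b : ℝ, a < b → ∃ g, StepPath ε C a b g ∧ g a = x ∧ g b = y := by
  refine hconn.induction₂' (fun x y => ∀ a b : ℝ, a < b → ∃ g, StepPath ε C a b g ∧
    g a = x ∧ g b = y) (fun x hx => ?_) (fun x y z hx hy hz hxy hyz a b hab => ?_) hx hy
  · obtain ⟨V, hVsub, hV, hxV, hVc⟩ := locallyConnectedSpace_iff_subsets_isOpen_isConnected.1
      inferInstance x (C ∩ Metric.ball x (ε / 2))
      (inter_mem (hC.mem_nhds hx) (Metric.ball_mem_nhds x (half_pos hε)))
    have hdiam : ∀ u ∈ V, ∀ v ∈ V, dist u v ≤ ε := by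
      intro u hu v hv
      have h1 : dist u x < ε / 2 := (hVsub hu).2
      have h2 : dist v x < ε / 2 := (hVsub hv).2
      linarith [dist_triangle_right u v x]
    have key : ∀ u ∈ V, ∀ v ∈ V, ∀ a b : ℝ, a < b →
        ∃ g, StepPath ε C a b g ∧ g a = u ∧ g b = v := by
      intro u hu v hv a b hab
      -- Step paths need not be continuous: a jump inside `V` is enough.
      refine ⟨fun t => if t ≤ a then u else v, base hab V (fun z hz => (hVsub hz).1) hV
        hVc.isPreconnected hdiam fun t _ => ?_, by simp, by simp [hab]⟩
      show ite _ _ _ ∈ V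
      split_ifs <;> assumption
    filter_upwards [mem_nhdsWithin_of_mem_nhds (hV.mem_nhds hxV)] with y hy
    exact ⟨key x hxV y hy, key y hy x hxV⟩
  · obtain ⟨m, ham, hmb⟩ := exists_between hab
    obtain ⟨g₁, h₁, h₁a, h₁m⟩ := hxy a m ham
    obtain ⟨g₂, h₂, h₂m, h₂b⟩ := hyz m b hmb
    exact ⟨_, h₁.concat_ite h₂ (h₁m.trans h₂m.symm), by simp [ham.le, h₁a], by simp [hmb, h₂b]⟩

/-- Each piece is refined inside its own connected open set, of diameter at most `ε`, so no value
moves further than `ε`. -/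
theorem exists_refinement [LocallyConnectedSpace X] (h : StepPath ε S a b g) (hε' : 0 < ε') :
    ∃ g', StepPath ε' S a b g' ∧ g' a = g a ∧ g' b = g b ∧
      ∀ t ∈ Icc a b, dist (g t) (g' t) ≤ ε := by
  induction h with
  | @base a b g hab C hCS hC hconn hdiam hg =>
    obtain ⟨g', hg', ha, hb⟩ := exists_of_isPreconnected hε' hC hconn
      (hg a (left_mem_Icc.2 hab.le)) (hg b (right_mem_Icc.2 hab.le)) a b hab
    exact ⟨g', hg'.mono hCS, ha, hb, fun t ht => hdiam _ (hg t ht) _ (hg'.mem t ht)⟩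
  | @concat a b c g h₁ h₂ ih₁ ih₂ =>
    obtain ⟨g₁, h₁', h₁a, h₁b, hd₁⟩ := ih₁
    obtain ⟨g₂, h₂', h₂b, h₂c, hd₂⟩ := ih₂
    refine ⟨_, h₁'.concat_ite h₂' (h₁b.trans h₂b.symm), by simp [h₁.lt.le, h₁a],
      by simp [h₂.lt, h₂c], fun t ht => ?_⟩
    split_ifs with h
    · exact hd₁ t ⟨ht.1, h⟩
    · exact hd₂ t ⟨(not_le.1 h).le, ht.2⟩

end StepPath

section

variable {X : Type*} [MetricSpace X]

/-! ### Local path connectedness -/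

/-- In a complete locally connected metric space, two points of a connected open set are joined by
a path in its closure. -/
theorem IsPreconnected.joinedIn_closure [CompleteSpace X] [LocallyConnectedSpace X] {V : Set X}
    (hconn : IsPreconnected V) (hV : IsOpen V) {x y : X} (hx : x ∈ V) (hy : y ∈ V) :
    JoinedIn (closure V) x y := by
  have hpos : ∀ n : ℕ, (0 : ℝ) < (1 / 2) ^ n := fun n => by positivity
  let T (n : ℕ) := {g : ℝ → X // StepPath ((1 / 2 : ℝ) ^ n) V 0 1 g ∧ g 0 = x ∧ g 1 = y}
  have hT0 : Nonempty (T 0) := by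
    obtain ⟨g, hg⟩ := StepPath.exists_of_isPreconnected (hpos 0) hV hconn hx hy 0 1 one_pos
    exact ⟨⟨g, hg⟩⟩
  have hnext : ∀ n, ∀ g : T n, ∃ g' : T (n + 1), ∀ t ∈ Icc (0 : ℝ) 1,
      dist (g.1 t) (g'.1 t) ≤ 1 * (1 / 2) ^ n := by
    rintro n ⟨g, hg, h0, h1⟩
    obtain ⟨g', hg', h0', h1', hd⟩ := hg.exists_refinement (hpos (n + 1))
    exact ⟨⟨g', hg', h0'.trans h0, h1'.trans h1⟩, by simpa using hd⟩
  choose next hnext using hnext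
  let F : (n : ℕ) → T n := fun n => Nat.rec hT0.some next n
  have hF : ∀ n, ∀ t ∈ Icc (0 : ℝ) 1, dist ((F n).1 t) ((F (n + 1)).1 t) ≤ 1 * (1 / 2) ^ n :=
    fun n t ht => hnext n (F n) t ht
  have hlim : ∀ t : ℝ, ∃ z, t ∈ Icc (0 : ℝ) 1 → Tendsto (fun n => (F n).1 t) atTop (𝓝 z) := by
    intro t
    by_cases ht : t ∈ Icc (0 : ℝ) 1
    · obtain ⟨z, hz⟩ := cauchySeq_tendsto_of_complete
        (cauchySeq_of_le_geometric (1 / 2) 1 (by norm_num) fun n => hF n t ht)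
      exact ⟨z, fun _ => hz⟩
    · exact ⟨x, fun h => absurd h ht⟩
  choose G hG using hlim
  have hdist : ∀ n, ∀ t ∈ Icc (0 : ℝ) 1, dist ((F n).1 t) (G t) ≤ 2 * (1 / 2) ^ n := by
    intro n t ht
    exact (dist_le_of_le_geometric_of_tendsto (1 / 2) 1 (by norm_num) (fun n => hF n t ht)
      (hG t ht) n).trans_eq (by ring)
  have h0 : (0 : ℝ) ∈ Icc (0 : ℝ) 1 := by simp
  have h1 : (1 : ℝ) ∈ Icc (0 : ℝ) 1 := by simp
  refine JoinedIn.ofLine (f := G) ?_ ?_ ?_ ?_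
  · intro t ht
    refine Metric.tendsto_nhds.2 fun η hη => ?_
    -- Two approximation errors `2 * (1 / 2) ^ n` and one oscillation `(1 / 2) ^ n` make the factor
    -- 5.
    obtain ⟨n, hn⟩ := exists_pow_lt_of_lt_one (show 0 < η / 5 by positivity)
      (show (1 / 2 : ℝ) < 1 by norm_num)
    filter_upwards [(F n).2.1.eventually_dist_le t ht, self_mem_nhdsWithin] with s hs hs'
    have e1 := hdist n t ht
    have e2 := hdist n s hs'
    rw [dist_comm] at e2
    linarith [dist_triangle4 (G s) ((F n).1 s) ((F n).1 t) (G t)]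
  · refine tendsto_nhds_unique (hG 0 h0) ?_
    simp only [(F _).2.2.1, tendsto_const_nhds]
  · refine tendsto_nhds_unique (hG 1 h1) ?_
    simp only [(F _).2.2.2, tendsto_const_nhds]
  · rintro _ ⟨t, ht, rfl⟩
    exact mem_closure_of_tendsto (hG t ht) (Eventually.of_forall fun n => (F n).2.1.mem t ht)

/-- A complete locally connected metric space is locally path connected. -/
theorem LocallyConnectedSpace.locallyPathConnectedSpace [CompleteSpace X]
    [LocallyConnectedSpace X] : LocallyPathConnectedSpace X where
  path_connected_basis x := by
    rw [hasBasis_self]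
    intro U hU
    obtain ⟨W, hW, hWc, hWU⟩ := exists_mem_nhds_isClosed_subset hU
    obtain ⟨V, hVW, hV, hxV, hVc⟩ := locallyConnectedSpace_iff_subsets_isOpen_isConnected.1
      inferInstance x W hW
    have hsub : V ⊆ pathComponentIn U x := fun y hy =>
      (hVc.isPreconnected.joinedIn_closure hV hxV hy).mono
        ((closure_minimal hVW hWc).trans hWU)
    exact ⟨pathComponentIn U x, mem_of_superset (hV.mem_nhds hxV) hsub,
      isPathConnected_pathComponentIn (mem_of_mem_nhds hU), pathComponentIn_subset⟩

/-! ### Building simple closed curves from arcs -/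

/-- A closed path which is otherwise injective traces out a simple closed curve. -/
theorem isSimpleClosedCurve_of_injOn_Ico {γ : ℝ → X} {a b : ℝ} (hab : a < b)
    (hγ : ContinuousOn γ (Icc a b)) (hinj : InjOn γ (Ico a b)) (hγab : γ a = γ b) :
    ∃ C : Set X, IsSimpleClosedCurve C := by
  have hp : 0 < b - a := sub_pos.2 hab
  have : Fact (0 < b - a) := ⟨hp⟩
  have hb : a + (b - a) = b := by ring
  have hc : Continuous (AddCircle.liftIco (b - a) a γ) :=
    AddCircle.liftIco_continuous (by rw [hb, hγab]) (by rwa [hb])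
  have hi : Function.Injective (AddCircle.liftIco (b - a) a γ) := by
    intro x y hxy
    refine (AddCircle.equivIco (b - a) a).injective (Subtype.ext (hinj ?_ ?_ hxy))
    · simpa only [hb] using (AddCircle.equivIco (b - a) a x).2
    · simpa only [hb] using (AddCircle.equivIco (b - a) a y).2
  exact ⟨_, ⟨((hc.isClosedEmbedding hi).isEmbedding.toHomeomorph.symm).trans
    (AddCircle.homeomorphCircle hp.ne')⟩⟩

/-- Two arcs with common endpoints and no other common points form a simple closed curve. -/
theorem isSimpleClosedCurve_of_two_arcs {α β : ℝ → X} {a b c d : ℝ} (hab : a < b) (hcd : c < d)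
    (hα : ContinuousOn α (Icc a b)) (hβ : ContinuousOn β (Icc c d))
    (hαi : InjOn α (Icc a b)) (hβi : InjOn β (Icc c d))
    (hac : α a = β c) (hbd : α b = β d)
    (hdisj : ∀ s ∈ Ioo a b, ∀ t ∈ Icc c d, α s ≠ β t) :
    ∃ C : Set X, IsSimpleClosedCurve C := by
  -- Run along `α`, then back along `β`.
  let δ : ℝ → X := fun t => if t ≤ b then α t else β (d - (t - b))
  have hδ₁ : EqOn δ α (Icc a b) := fun t ht => if_pos ht.2
  have hδ₂ : EqOn δ (fun t => β (d - (t - b))) (Icc b (b + (d - c))) := by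
    intro t ht
    rcases ht.1.eq_or_lt with rfl | h
    · simp [δ, hbd]
    · simp [δ, h]
  have hne : ∀ s ∈ Icc a b, ∀ t ∈ Ico b (b + (d - c)), δ s = δ t → s = t := by
    intro s hs t ht hst
    rcases ht.1.eq_or_lt with rfl | h
    · rw [hδ₁ hs, hδ₁ (right_mem_Icc.2 hab.le)] at hst
      exact hαi hs (right_mem_Icc.2 hab.le) hst
    rw [hδ₁ hs, hδ₂ ⟨ht.1, ht.2.le⟩] at hst
    have htm : d - (t - b) ∈ Icc c d := ⟨by linarith [ht.2], by linarith⟩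
    rcases hs.1.eq_or_lt with rfl | h1
    · rw [hac] at hst
      have := hβi (left_mem_Icc.2 hcd.le) htm hst
      linarith [ht.2]
    rcases hs.2.eq_or_lt with rfl | h2
    · rw [hbd] at hst
      have := hβi (right_mem_Icc.2 hcd.le) htm hst
      linarith
    · exact absurd hst (hdisj s ⟨h1, h2⟩ _ htm)
  refine isSimpleClosedCurve_of_injOn_Ico (γ := δ) (a := a) (b := b + (d - c)) (by linarith)
    ?_ ?_ ?_
  · rw [← Icc_union_Icc_eq_Icc hab.le (by linarith)]
    refine (hα.congr hδ₁).union_of_isClosed (ContinuousOn.congr ?_ hδ₂) isClosed_Icc isClosed_Icc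
    exact hβ.comp (by fun_prop) fun t ht => ⟨by linarith [ht.2], by linarith [ht.1]⟩
  · intro s hs t ht hst
    rcases le_total s b with h | h <;> rcases le_total t b with h' | h'
    · rw [hδ₁ ⟨hs.1, h⟩, hδ₁ ⟨ht.1, h'⟩] at hst
      exact hαi ⟨hs.1, h⟩ ⟨ht.1, h'⟩ hst
    · exact hne s ⟨hs.1, h⟩ t ⟨h', ht.2⟩ hst
    · exact (hne t ⟨ht.1, h'⟩ s ⟨h, hs.2⟩ hst.symm).symm
    · rw [hδ₂ ⟨h, hs.2.le⟩, hδ₂ ⟨h', ht.2.le⟩] at hst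
      have := hβi (x₁ := d - (s - b)) (x₂ := d - (t - b)) ⟨by linarith [hs.2], by linarith⟩
        ⟨by linarith [ht.2], by linarith⟩ hst
      linarith
  · rw [hδ₁ (left_mem_Icc.2 hab.le), hδ₂ (right_mem_Icc.2 (by linarith)), hac]
    congr 1
    ring

/-- Two arcs with common endpoints, one of which leaves the other, contain a simple closed
curve. -/
theorem isSimpleClosedCurve_of_arc_leaving {α β : ℝ → X} {a b c d t₀ : ℝ} (hcd : c ≤ d)
    (hα : ContinuousOn α (Icc a b)) (hβ : ContinuousOn β (Icc c d))
    (hαi : InjOn α (Icc a b)) (hβi : InjOn β (Icc c d))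
    (hac : α a = β c) (hbd : α b = β d)
    (ht₀ : t₀ ∈ Icc a b) (hout : α t₀ ∉ β '' Icc c d) :
    ∃ C : Set X, IsSimpleClosedCurve C := by
  have hclosed : IsClosed (β '' Icc c d) := (isCompact_Icc.image_of_continuousOn hβ).isClosed
  have hcomp : IsCompact (Icc a b ∩ α ⁻¹' (β '' Icc c d)) :=
    isCompact_Icc.of_isClosed_subset
      (hα.preimage_isClosed_of_isClosed isClosed_Icc hclosed) inter_subset_left
  -- `s₀` and `s₁` are the last time before `t₀` and the first after it at which `α` meets `β`.
  obtain ⟨s₀, ⟨⟨hs₀I, u, hu, hus⟩, hs₀t⟩, hs₀max⟩ :=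
    (hcomp.inter_right (isClosed_Iic (a := t₀))).exists_isGreatest
      ⟨a, ⟨left_mem_Icc.2 (ht₀.1.trans ht₀.2), c, left_mem_Icc.2 hcd, hac.symm⟩, ht₀.1⟩
  obtain ⟨s₁, ⟨⟨hs₁I, v, hv, hvs⟩, hs₁t⟩, hs₁min⟩ :=
    (hcomp.inter_right (isClosed_Ici (a := t₀))).exists_isLeast
      ⟨b, ⟨right_mem_Icc.2 (ht₀.1.trans ht₀.2), d, right_mem_Icc.2 hcd, hbd.symm⟩, ht₀.2⟩
  simp only [mem_Iic, mem_Ici] at hs₀t hs₁t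
  have h₀ : s₀ < t₀ := hs₀t.lt_of_ne (by rintro rfl; exact hout ⟨u, hu, hus⟩)
  have h₁ : t₀ < s₁ := hs₁t.lt_of_ne (by rintro rfl; exact hout ⟨v, hv, hvs⟩)
  have hsub : Icc s₀ s₁ ⊆ Icc a b := Icc_subset_Icc hs₀I.1 hs₁I.2
  have hdisj : ∀ s ∈ Ioo s₀ s₁, ∀ t ∈ Icc c d, α s ≠ β t := by
    intro s hs t ht hst
    have hsA : s ∈ Icc a b ∩ α ⁻¹' (β '' Icc c d) :=
      ⟨hsub (Ioo_subset_Icc_self hs), t, ht, hst.symm⟩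
    rcases le_total s t₀ with h | h
    · exact (hs₀max ⟨hsA, h⟩).not_gt hs.1
    · exact (hs₁min ⟨hsA, h⟩).not_gt hs.2
  rcases lt_trichotomy u v with huv | rfl | huv
  · have hsub' : Icc u v ⊆ Icc c d := Icc_subset_Icc hu.1 hv.2
    exact isSimpleClosedCurve_of_two_arcs (h₀.trans h₁) huv (hα.mono hsub) (hβ.mono hsub')
      (hαi.mono hsub) (hβi.mono hsub') hus.symm hvs.symm
      fun s hs t ht => hdisj s hs t (hsub' ht)
  · have := hαi hs₀I hs₁I (hus.symm.trans hvs)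
    linarith
  · have hsub' : ∀ t ∈ Icc (-u) (-v), -t ∈ Icc c d := fun t ht =>
      ⟨by linarith [ht.2, hv.1], by linarith [ht.1, hu.2]⟩
    refine isSimpleClosedCurve_of_two_arcs (β := fun t => β (-t)) (h₀.trans h₁)
      (neg_lt_neg huv) (hα.mono hsub) (hβ.comp (by fun_prop) hsub')
      (hαi.mono hsub) (fun s hs t ht hst => neg_injective (hβi (hsub' s hs) (hsub' t ht) hst))
      (by simp [hus]) (by simp [hvs]) fun s hs t ht => hdisj s hs _ (hsub' t ht)

/-! ### Extracting an arc from a path -/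

/-- A minimal closed subset of `[0, 1]` such that a path takes equal values at the two ends of each
of its gaps. -/
theorem exists_closed_injective_modulo_gaps {γ : ℝ → X} (hγ : Continuous γ) :
    ∃ K : Set ℝ, IsClosed K ∧ K ⊆ Icc 0 1 ∧ 0 ∈ K ∧ 1 ∈ K ∧
      (∀ a ∈ K, ∀ b ∈ K, a < b → (∀ k ∈ K, k ∉ Ioo a b) → γ a = γ b) ∧
      (∀ a ∈ K, ∀ b ∈ K, a < b → γ a = γ b → ∀ k ∈ K, k ∉ Ioo a b) := by
  let S : Set (Set ℝ) := {K | IsClosed K ∧ K ⊆ Icc 0 1 ∧ 0 ∈ K ∧ 1 ∈ K ∧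
      (∀ a ∈ K, ∀ b ∈ K, a < b → (∀ k ∈ K, k ∉ Ioo a b) → γ a = γ b)}
  obtain ⟨K, hK⟩ : ∃ K, Minimal (· ∈ S) K := by
    refine zorn_superset S fun c hcS hc => ?_
    rcases c.eq_empty_or_nonempty with rfl | hne
    · refine ⟨Icc 0 1, ⟨isClosed_Icc, Subset.rfl, by simp, by simp, ?_⟩, by simp⟩
      intro a ha b hb hab h
      exact absurd (show (a + b) / 2 ∈ Ioo a b from ⟨by linarith, by linarith⟩)
        (h _ ⟨by linarith [ha.1, hb.1], by linarith [ha.2, hb.2]⟩)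
    obtain ⟨K₀, hK₀⟩ := hne
    refine ⟨⋂₀ c, ⟨isClosed_sInter fun K hK => (hcS hK).1,
      (sInter_subset_of_mem hK₀).trans (hcS hK₀).2.1, fun K hK => (hcS hK).2.2.1,
      fun K hK => (hcS hK).2.2.2.1, ?_⟩, fun K hK => sInter_subset_of_mem hK⟩
    intro a ha b hb hab h
    by_contra hne
    have hd : 0 < dist (γ a) (γ b) := dist_pos.2 hne
    obtain ⟨η₁, hη₁, h₁⟩ := Metric.continuous_iff.1 hγ a _ (half_pos hd)
    obtain ⟨η₂, hη₂, h₂⟩ := Metric.continuous_iff.1 hγ b _ (half_pos hd)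
    obtain ⟨η, hη, hηlt⟩ := exists_between (lt_min (lt_min hη₁ hη₂) (half_pos (sub_pos.2 hab)))
    rw [lt_min_iff, lt_min_iff] at hηlt
    -- By compactness some member of the chain already misses the middle of the gap; the ends of its
    -- own gap there are `η`-close to `a` and `b`.
    obtain ⟨K, hKc, hK⟩ : ∃ K ∈ c, Icc (a + η) (b - η) ∩ K = ∅ := by
      have : Nonempty c := ⟨⟨K₀, hK₀⟩⟩
      obtain ⟨⟨K, hKc⟩, hK⟩ := (isCompact_Icc (a := a + η) (b := b - η)).elim_directed_family_closed
        (fun K : c => K.1) (fun K => (hcS K.2).1) (by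
          rw [← sInter_eq_iInter, eq_empty_iff_forall_notMem]
          exact fun k hk => h k hk.2 ⟨by linarith [hk.1.1], by linarith [hk.1.2]⟩) (by
          rintro ⟨K, hK⟩ ⟨K', hK'⟩
          rcases hc.total hK hK' with h | h
          · exact ⟨⟨K, hK⟩, Subset.rfl, h⟩
          · exact ⟨⟨K', hK'⟩, h, Subset.rfl⟩)
      exact ⟨K, hKc, hK⟩
    obtain ⟨hKcl, -, -, -, hgap⟩ := hcS hKc
    obtain ⟨a', ⟨ha'K, ha'⟩, ha'max⟩ := (isCompact_Icc.inter_left hKcl).exists_isGreatest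
      (s := K ∩ Icc a (a + η)) ⟨a, ha K hKc, le_rfl, by linarith⟩
    obtain ⟨b', ⟨hb'K, hb'⟩, hb'min⟩ := (isCompact_Icc.inter_left hKcl).exists_isLeast
      (s := K ∩ Icc (b - η) b) ⟨b, hb K hKc, by linarith, le_rfl⟩
    have hab' : γ a' = γ b' := by
      refine hgap a' ha'K b' hb'K (by linarith [ha'.2, hb'.1]) fun k hk hkab => ?_
      rcases le_total k (a + η) with h | h
      · exact (ha'max ⟨hk, ha'.1.trans hkab.1.le, h⟩).not_gt hkab.1
      rcases le_total (b - η) k with h' | h'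
      · exact (hb'min ⟨hk, h', hkab.2.le.trans hb'.2⟩).not_gt hkab.2
      · exact (hK ▸ (⟨⟨h, h'⟩, hk⟩ : k ∈ Icc (a + η) (b - η) ∩ K) : k ∈ (∅ : Set ℝ))
    have e₁ := h₁ a' (by rw [Real.dist_eq, abs_lt]; constructor <;> linarith [ha'.1, ha'.2])
    have e₂ := h₂ b' (by rw [Real.dist_eq, abs_lt]; constructor <;> linarith [hb'.1, hb'.2])
    rw [hab'] at e₁
    linarith [dist_triangle_left (γ a) (γ b) (γ b')]
  obtain ⟨hKcl, hKI, h0, h1, hgap⟩ := hK.prop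
  refine ⟨K, hKcl, hKI, h0, h1, hgap, fun a ha b hb hab hγab k hk hkab => ?_⟩
  -- Removing `(a, b)` creates no new gap except `(a, b)` itself, so minimality of `K` forbids
  -- points of `K` there.
  have hsub : K \ Ioo a b ∈ S := by
    refine ⟨hKcl.sdiff isOpen_Ioo, sdiff_subset.trans hKI, ⟨h0, fun h => ?_⟩,
      ⟨h1, fun h => ?_⟩, fun u hu v hv huv h => ?_⟩
    · exact (hKI ha).1.not_gt h.1
    · exact (hKI hb).2.not_gt h.2
    by_cases hcase : ∃ k ∈ K, k ∈ Ioo u v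
    · obtain ⟨l, hl, hluv⟩ := hcase
      have hlab : l ∈ Ioo a b := by
        by_contra hlab
        exact h l ⟨hl, hlab⟩ hluv
      have hua : u = a := by
        refine le_antisymm (not_lt.1 fun hau => hu.2 ⟨hau, hluv.1.trans hlab.2⟩)
          (not_lt.1 fun hua => h a ⟨ha, fun h => lt_irrefl _ h.1⟩ ⟨hua, hlab.1.trans hluv.2⟩)
      have hvb : v = b := by
        refine le_antisymm (not_lt.1 fun hbv =>
          h b ⟨hb, fun h => lt_irrefl _ h.2⟩ ⟨hluv.1.trans hlab.2, hbv⟩)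
          (not_lt.1 fun hvb => hv.2 ⟨hlab.1.trans hluv.2, hvb⟩)
      rw [hua, hvb, hγab]
    · push Not at hcase
      exact hgap u hu.1 v hv.1 huv hcase
  exact (hK.le_of_le hsub sdiff_subset hk).2 hkab

/-- Every path can be replaced by a path with connected fibers. -/
theorem exists_path_ordConnected_fibers {γ : ℝ → X} (hγ : Continuous γ) :
    ∃ δ : ℝ → X, ContinuousOn δ (Icc 0 1) ∧ δ 0 = γ 0 ∧ δ 1 = γ 1 ∧
      (∀ t ∈ Icc (0 : ℝ) 1, δ t ∈ γ '' Icc 0 1) ∧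
      ∀ s ∈ Icc (0 : ℝ) 1, ∀ t ∈ Icc (0 : ℝ) 1, δ s = δ t → ∀ u ∈ Icc s t, δ u = δ s := by
  obtain ⟨K, hKcl, hKI, h0, h1, hgap, hinj⟩ := exists_closed_injective_modulo_gaps hγ
  -- `p u` is the last point of `K` up to `u`; the new path `γ ∘ p` is constant on each gap, the
  -- right end included.
  have hp : ∀ u : ℝ, ∃ p, u ∈ Icc (0 : ℝ) 1 → IsGreatest (K ∩ Icc 0 u) p := by
    intro u
    by_cases hu : u ∈ Icc (0 : ℝ) 1
    · obtain ⟨p, hp⟩ := (isCompact_Icc.inter_left hKcl).exists_isGreatest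
        (s := K ∩ Icc 0 u) ⟨0, h0, le_rfl, hu.1⟩
      exact ⟨p, fun _ => hp⟩
    · exact ⟨0, fun h => absurd h hu⟩
  choose p hp using hp
  have hpmem : ∀ u ∈ Icc (0 : ℝ) 1, p u ∈ K := fun u hu => (hp u hu).1.1
  have hple : ∀ u ∈ Icc (0 : ℝ) 1, p u ≤ u := fun u hu => (hp u hu).1.2.2
  have hpmax : ∀ u ∈ Icc (0 : ℝ) 1, ∀ k ∈ K, k ≤ u → k ≤ p u := fun u hu k hk hku =>
    (hp u hu).2 ⟨hk, (hKI hk).1, hku⟩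
  have hpK : ∀ k ∈ K, p k = k := fun k hk =>
    (hple k (hKI hk)).antisymm (hpmax k (hKI hk) k hk le_rfl)
  have hr : ∀ u ∈ Icc (0 : ℝ) 1, ∃ r ∈ K, u ≤ r ∧ (∀ k ∈ K, u ≤ k → r ≤ k) ∧ γ (p u) = γ r := by
    intro u hu
    obtain ⟨r, hr, hrmin⟩ := (isCompact_Icc.inter_left hKcl).exists_isLeast
        (s := K ∩ Icc u 1) ⟨1, h1, hu.2, le_rfl⟩
    have hrmin' : ∀ k ∈ K, u ≤ k → r ≤ k := fun k hk huk => hrmin ⟨hk, huk, (hKI hk).2⟩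
    refine ⟨r, hr.1, hr.2.1, hrmin', ?_⟩
    rcases ((hple u hu).trans hr.2.1).eq_or_lt with h | h
    · rw [h]
    · refine hgap _ (hpmem u hu) _ hr.1 h fun k hk hkI => ?_
      rcases le_total k u with hku | hku
      · exact (hpmax u hu k hk hku).not_gt hkI.1
      · exact (hrmin' k hk hku).not_gt hkI.2
  -- Either the new path agrees at `u` and `v`, or `γ` takes both values on `[u, v]`; hence it
  -- inherits the modulus of continuity of `γ`.
  have hdich : ∀ u ∈ Icc (0 : ℝ) 1, ∀ v ∈ Icc (0 : ℝ) 1, u ≤ v → γ (p u) = γ (p v) ∨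
      ∃ s ∈ Icc u v, ∃ t ∈ Icc u v, γ (p u) = γ s ∧ γ (p v) = γ t := by
    intro u hu v hv huv
    obtain ⟨r, hrK, hur, hrmin, hγr⟩ := hr u hu
    rcases le_or_gt r v with h | h
    · have hrp := hpmax v hv r hrK h
      exact Or.inr ⟨r, ⟨hur, h⟩, p v, ⟨hur.trans hrp, hple v hv⟩, hγr, rfl⟩
    · left
      congr 1
      refine (hpmax v hv _ (hpmem u hu) ((hple u hu).trans huv)).antisymm
        (hpmax u hu _ (hpmem v hv) (not_lt.1 fun hlt => ?_))
      exact (hrmin _ (hpmem v hv) hlt.le).not_gt ((hple v hv).trans_lt h)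
  refine ⟨fun u => γ (p u), ?_, by simp [hpK 0 h0], by simp [hpK 1 h1],
    fun t ht => ⟨p t, hKI (hpmem t ht), rfl⟩, ?_⟩
  · refine UniformContinuousOn.continuousOn (Metric.uniformContinuousOn_iff.2 fun ε hε => ?_)
    obtain ⟨d, hd, h⟩ := Metric.uniformContinuousOn_iff.1
      (isCompact_Icc.uniformContinuousOn_of_continuous hγ.continuousOn) ε hε
    have key : ∀ u ∈ Icc (0 : ℝ) 1, ∀ v ∈ Icc (0 : ℝ) 1, u ≤ v → dist u v < d →
        dist (γ (p u)) (γ (p v)) < ε := by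
      intro u hu v hv huv huvd
      rcases hdich u hu v hv huv with h' | ⟨s, hs, t, ht, hus, hvt⟩
      · rwa [h', dist_self]
      · rw [hus, hvt]
        exact h s ⟨hu.1.trans hs.1, hs.2.trans hv.2⟩ t ⟨hu.1.trans ht.1, ht.2.trans hv.2⟩
          ((Real.dist_le_of_mem_Icc hs ht).trans_lt (by
            rwa [Real.dist_eq, abs_sub_comm, abs_of_nonneg (sub_nonneg.2 huv)] at huvd))
    refine ⟨d, hd, fun u hu v hv huvd => ?_⟩
    rcases le_total u v with huv | huv
    · exact key u hu v hv huv huvd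
    · rw [dist_comm] at huvd ⊢
      exact key v hv u hu huv huvd
  · intro s hs t ht hst u hu
    have huI : u ∈ Icc (0 : ℝ) 1 := ⟨hs.1.trans hu.1, hu.2.trans ht.2⟩
    have hsu : p s ≤ p u := hpmax u huI _ (hpmem s hs) ((hple s hs).trans hu.1)
    have hut : p u ≤ p t := hpmax t ht _ (hpmem u huI) ((hple u huI).trans hu.2)
    rcases hsu.eq_or_lt with h | h
    · simp only [h]
    rcases hut.eq_or_lt with h' | h'
    · simp only [h']
      exact hst.symm
    · exact absurd ⟨h, h'⟩
        (hinj _ (hpmem s hs) _ (hpmem t ht) (h.trans h') hst _ (hpmem u huI))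

/-- The largest distance, cut off at `1`, from `δ q` of a value of `δ` on `[q, t]`. -/
noncomputable def runningSup (δ : I → X) (q t : I) : ℝ :=
  sSup ((fun r : I => min 1 (dist (δ q) (δ (max q (min r t))))) '' univ)

namespace runningSup

variable {δ : I → X} {q s t : I}

theorem bddAbove : BddAbove ((fun r : I => min 1 (dist (δ q) (δ (max q (min r t))))) '' univ) :=
  ⟨1, by rintro _ ⟨r, -, rfl⟩; exact min_le_left _ _⟩

theorem le_of_forall {c : ℝ} (h : ∀ r : I, min 1 (dist (δ q) (δ (max q (min r t)))) ≤ c) :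
    runningSup δ q t ≤ c :=
  csSup_le (univ_nonempty.image _) (by rintro _ ⟨r, -, rfl⟩; exact h r)

theorem le_self (r : I) : min 1 (dist (δ q) (δ (max q (min r t)))) ≤ runningSup δ q t :=
  le_csSup bddAbove ⟨r, mem_univ _, rfl⟩

theorem nonneg : 0 ≤ runningSup δ q t :=
  (le_min zero_le_one dist_nonneg).trans (le_self 0)

theorem le_one : runningSup δ q t ≤ 1 := le_of_forall fun _ => min_le_left _ _

theorem continuous (hδ : Continuous δ) : Continuous (runningSup δ q) :=
  isCompact_univ.continuous_sSup
    (f := fun t r : I => min 1 (dist (δ q) (δ (max q (min r t))))) (by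
      simp only [Function.HasUncurry.uncurry, id]
      fun_prop)

theorem monotone : Monotone (runningSup δ q) := by
  intro s t hst
  refine le_of_forall fun r => ?_
  have := le_self (δ := δ) (q := q) (t := t) (min r s)
  rwa [min_assoc, min_eq_left hst] at this

theorem eq_zero (h : t ≤ q) : runningSup δ q t = 0 := by
  refine le_antisymm (le_of_forall fun r => ?_) nonneg
  rw [max_eq_left ((min_le_right _ _).trans h), dist_self]
  exact min_le_right _ _

theorem pos (hqt : q ≤ t) (hne : δ q ≠ δ t) : 0 < runningSup δ q t := by
  refine (lt_min one_pos (dist_pos.2 hne)).trans_le ?_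
  simpa [max_eq_right hqt] using le_self (δ := δ) (q := q) (t := t) t

/-- A stretch where `δ` is constant contributes no new distance; if `q` lies in it, the distances
there vanish. -/
theorem eq_of_const (hst : s ≤ t) (h : ∀ u ∈ Icc s t, δ u = δ s) :
    runningSup δ q s = runningSup δ q t := by
  refine (monotone hst).antisymm (le_of_forall fun r => ?_)
  rcases le_total (min r t) s with hr | hr
  · simpa [min_eq_left hr] using le_self (δ := δ) (q := q) (t := s) (min r t)
  rcases le_total q s with hq | hq
  · have e : δ (max q (min r t)) = δ (max q (min s s)) := by
      rw [min_self, max_eq_right hq, max_eq_right (hq.trans hr)]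
      exact h _ ⟨hr, min_le_right _ _⟩
    rw [e]
    exact le_self s
  · have e : δ q = δ (max q (min r t)) := by
      rcases le_total q (min r t) with hq' | hq'
      · rw [max_eq_right hq', h q ⟨hq, hq'.trans (min_le_right _ _)⟩,
          h _ ⟨hr, min_le_right _ _⟩]
      · rw [max_eq_left hq']
    rw [← e, dist_self]
    exact (min_le_right _ _).trans nonneg

end runningSup

/-- A path with connected fibers admits a monotone continuous function with the same fibers. -/
theorem exists_monotone_same_fibers {δ : I → X} (hδ : Continuous δ)
    (hfib : ∀ s t, δ s = δ t → ∀ u ∈ Icc s t, δ u = δ s) :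
    ∃ φ : I → ℝ, Continuous φ ∧ Monotone φ ∧ φ 0 = 0 ∧ ∀ s t, φ s = φ t ↔ δ s = δ t := by
  let q : ℕ → I := TopologicalSpace.denseSeq I
  let F : ℕ → I → ℝ := fun n t => (1 / 2) ^ n * runningSup δ (q n) t
  have hF0 : ∀ n t, 0 ≤ F n t := fun n t => mul_nonneg (by positivity) runningSup.nonneg
  have hF1 : ∀ n t, F n t ≤ (1 / 2) ^ n := fun n t =>
    mul_le_of_le_one_right (by positivity) runningSup.le_one
  have hsum : ∀ t, Summable fun n => F n t := fun t =>
    Summable.of_nonneg_of_le (fun n => hF0 n t) (fun n => hF1 n t) summable_geometric_two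
  have hmono : ∀ n, Monotone (F n) := fun n s t hst =>
    mul_le_mul_of_nonneg_left (runningSup.monotone hst) (by positivity)
  have heq : ∀ s t, s ≤ t → δ s = δ t → ∑' n, F n s = ∑' n, F n t := by
    intro s t hst h
    refine tsum_congr fun n => ?_
    simp only [F, runningSup.eq_of_const hst (hfib s t h)]
  have hlt : ∀ s t, s < t → δ s ≠ δ t → ∑' n, F n s < ∑' n, F n t := by
    intro s t hst hne
    -- This yields some `q n` in `(s, t)` with `δ (q n) ≠ δ t`, whose running supremum is zero at
    -- `s` and positive at `t`.
    obtain ⟨u, hu, hut⟩ : ∃ u ∈ Ioo s t, δ u ≠ δ t := by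
      by_contra! h
      have : closure (Ioo s t) ⊆ {u | δ u = δ t} :=
        closure_minimal h (isClosed_eq hδ continuous_const)
      rw [closure_Ioo hst.ne] at this
      exact hne (this (left_mem_Icc.2 hst.le))
    obtain ⟨n, hn, hnt⟩ := (TopologicalSpace.denseRange_denseSeq I).exists_mem_open
      (isOpen_Ioo.inter (isOpen_ne_fun hδ (continuous_const (y := δ t)))) ⟨u, hu, hut⟩
    refine Summable.tsum_lt_tsum (i := n) (fun n => hmono n hst.le) ?_ (hsum s) (hsum t)
    refine mul_lt_mul_of_pos_left ?_ (by positivity)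
    rw [runningSup.eq_zero hn.1.le]
    exact runningSup.pos hn.2.le hnt
  refine ⟨fun t => ∑' n, F n t, ?_, fun s t hst => ?_, ?_, fun s t => ⟨fun h => ?_, fun h => ?_⟩⟩
  · refine continuous_tsum (fun n => (runningSup.continuous hδ).const_mul _ |>.congr fun _ => rfl)
      summable_geometric_two fun n t => ?_
    rw [Real.norm_of_nonneg (hF0 n t)]
    exact hF1 n t
  · exact (hsum s).tsum_le_tsum (fun n => hmono n hst) (hsum t)
  · simp [F, runningSup.eq_zero unitInterval.nonneg']
  · by_contra hne
    rcases lt_trichotomy s t with hst | rfl | hst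
    · exact (hlt s t hst hne).ne h
    · exact hne rfl
    · exact (hlt t s hst (Ne.symm hne)).ne' h
  · rcases le_total s t with hst | hst
    · exact heq s t hst h
    · exact (heq t s hst h.symm).symm

/-- Distinct points joined by a path in a set are joined by an arc in that set. -/
theorem JoinedIn.exists_arc {U : Set X} {x y : X} (h : JoinedIn U x y) (hxy : x ≠ y) :
    ∃ α : ℝ → X, ContinuousOn α (Icc 0 1) ∧ InjOn α (Icc 0 1) ∧ α 0 = x ∧ α 1 = y ∧
      ∀ t ∈ Icc (0 : ℝ) 1, α t ∈ U := by
  obtain ⟨γ, hγ⟩ := h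
  obtain ⟨δ', hδ', h0, h1, hmem, hfib⟩ := exists_path_ordConnected_fibers γ.continuous_extend
  let δ : I → X := fun t => δ' t
  have hδ : Continuous δ := continuousOn_iff_continuous_domRestrict.1 hδ'
  have hδ0 : δ 0 = x := by simp [δ, h0]
  have hδ1 : δ 1 = y := by simp [δ, h1]
  have hδU : ∀ t, δ t ∈ U := by
    intro t
    obtain ⟨s, hs, hst⟩ := hmem t t.2
    rw [show δ t = _ from hst.symm, γ.extend_apply hs]
    exact hγ _
  obtain ⟨φ, hφ, hmono, hφ0, hφδ⟩ := exists_monotone_same_fibers hδ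
    fun s t hst u hu => hfib s s.2 t t.2 hst u hu
  have hL : 0 < φ 1 := by
    refine lt_of_le_of_ne (hφ0 ▸ hmono unitInterval.le_one') fun h => hxy ?_
    rw [← hδ0, ← hδ1, ← hφδ, hφ0, h]
  let ψ : I → I := fun t => ⟨φ t / φ 1, div_nonneg (hφ0 ▸ hmono unitInterval.nonneg') hL.le,
    (div_le_one hL).2 (hmono unitInterval.le_one')⟩
  have hψ : Continuous ψ := (hφ.div_const _).subtype_mk _
  have hψ0 : ψ 0 = 0 := Subtype.ext (by simp [ψ, hφ0])
  have hψ1 : ψ 1 = 1 := Subtype.ext (by simp [ψ, hL.ne'])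
  have hψs : Function.Surjective ψ := fun s =>
    intermediate_value_univ 0 1 hψ (by
      rw [hψ0, hψ1]; exact ⟨unitInterval.nonneg', unitInterval.le_one'⟩)
  have hψδ : ∀ s t, ψ s = ψ t ↔ δ s = δ t := by
    intro s t
    rw [← hφδ, Subtype.ext_iff]
    exact div_left_inj' hL.ne'
  -- `ψ` is a quotient map with the fibers of `δ`, so `δ` descends to a continuous injection `η`.
  let η : I → X := fun s => δ (Function.surjInv hψs s)
  have hηψ : ∀ t, η (ψ t) = δ t := fun t => (hψδ _ _).1 (Function.surjInv_eq hψs _)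
  have hη : Continuous η := by
    rw [(hψ.isClosedMap.isQuotientMap hψ hψs).continuous_iff]
    exact hδ.congr fun t => (hηψ t).symm
  have hηi : Function.Injective η := by
    intro s t hst
    rw [← Function.surjInv_eq hψs s, ← Function.surjInv_eq hψs t]
    exact (hψδ _ _).2 hst
  refine ⟨IccExtend zero_le_one η, hη.Icc_extend'.continuousOn, ?_, ?_, ?_, fun t ht => hδU _⟩
  · intro s hs t ht hst
    rw [IccExtend_of_mem _ _ hs, IccExtend_of_mem _ _ ht] at hst
    exact congrArg Subtype.val (hηi hst)
  · rw [IccExtend_left, ← hδ0, ← hηψ, hψ0]; rfl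
  · rw [IccExtend_right, ← hδ1, ← hηψ, hψ1]; rfl

/-! ### Absence of simple closed curves, and the theorem -/

/-- In a complete locally connected metric space without simple closed curves, a dense connected
set contains all interior points of every arc. -/
theorem arc_mem_of_dense_isPreconnected [CompleteSpace X] [LocallyConnectedSpace X]
    (hX : ∀ C : Set X, ¬ IsSimpleClosedCurve C) {P : Set X} (hP : Dense P)
    (hPc : IsPreconnected P) {α : ℝ → X} (hα : ContinuousOn α (Icc 0 1))
    (hαi : InjOn α (Icc 0 1)) {t : ℝ} (ht : t ∈ Ioo (0 : ℝ) 1) : α t ∈ P := by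
  by_contra hnot
  have : LocallyPathConnectedSpace X := LocallyConnectedSpace.locallyPathConnectedSpace
  have htI : t ∈ Icc (0 : ℝ) 1 := Ioo_subset_Icc_self ht
  have h0 : (0 : ℝ) ∈ Icc (0 : ℝ) 1 := by simp
  have h1 : (1 : ℝ) ∈ Icc (0 : ℝ) 1 := by simp
  have hO : IsOpen ({α t}ᶜ : Set X) := isOpen_compl_singleton
  have h0O : α 0 ∈ ({α t}ᶜ : Set X) := fun h => ht.1.ne (hαi h0 htI h)
  have h1O : α 1 ∈ ({α t}ᶜ : Set X) := fun h => ht.2.ne' (hαi h1 htI h)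
  have hPO : P ⊆ {α t}ᶜ := fun p hp h => hnot (mem_singleton_iff.1 h ▸ hp)
  have hsub : ∀ z ∈ ({α t}ᶜ : Set X), P ⊆ connectedComponentIn {α t}ᶜ z := by
    intro z hz
    obtain ⟨p, hpz, hpP⟩ := hP.inter_open_nonempty _ hO.connectedComponentIn
      ⟨z, mem_connectedComponentIn hz⟩
    rw [connectedComponentIn_eq hpz]
    exact hPc.subset_connectedComponentIn hpP hPO
  obtain ⟨p, hp⟩ : P.Nonempty := hP.nonempty_iff.2 ⟨α 0⟩
  have hcomp := (connectedComponentIn_eq (hsub _ h0O hp)).trans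
    (connectedComponentIn_eq (hsub _ h1O hp)).symm
  have hpath := hO.connectedComponentIn.isConnected_iff_isPathConnected.1
    (isConnected_connectedComponentIn_iff.2 h0O)
  obtain ⟨β, hβ, hβi, hβ0, hβ1, hβU⟩ := (hpath.joinedIn _ (mem_connectedComponentIn h0O) (α 1)
    (hcomp ▸ mem_connectedComponentIn h1O)).exists_arc (hαi.ne h0 h1 zero_ne_one)
  obtain ⟨C, hC⟩ := isSimpleClosedCurve_of_arc_leaving zero_le_one hα hβ hαi hβi hβ0.symm hβ1.symm
    htI (by
      rintro ⟨s, hs, hst⟩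
      exact connectedComponentIn_subset _ _ (hβU s hs) hst)
  exact hX C hC

/-- In a space without simple closed curves, a continuous map which is injective on the interior of
an arc separates its endpoints. -/
theorem ne_endpoints_of_injOn_Ioo (hX : ∀ C : Set X, ¬ IsSimpleClosedCurve C) {g : ℝ → X}
    {a b : ℝ} (hab : a < b) (hg : ContinuousOn g (Icc a b)) (hinj : InjOn g (Ioo a b)) :
    g a ≠ g b := by
  intro h
  have key : ∀ c ∈ Ioc a b, g a = g c → (∀ t ∈ Ioo a c, g t ≠ g a) → False := by
    intro c hc hac hne
    obtain ⟨C, hC⟩ := isSimpleClosedCurve_of_injOn_Ico hc.1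
      (hg.mono (Icc_subset_Icc_right hc.2)) (fun s hs t ht hst => by
        rcases hs.1.eq_or_lt with rfl | hs' <;> rcases ht.1.eq_or_lt with rfl | ht'
        · rfl
        · exact absurd hst.symm (hne t ⟨ht', ht.2⟩)
        · exact absurd hst (hne s ⟨hs', hs.2⟩)
        · exact hinj ⟨hs', hs.2.trans_le hc.2⟩ ⟨ht', ht.2.trans_le hc.2⟩ hst) hac
    exact hX C hC
  -- An interior return to `g a` is unique by injectivity, so the loop closes on `[a, c]`; otherwise
  -- on `[a, b]`.
  by_cases hc : ∃ c ∈ Ioo a b, g c = g a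
  · obtain ⟨c, hc, hca⟩ := hc
    exact key c ⟨hc.1, hc.2.le⟩ hca.symm fun t ht hta =>
      ht.2.ne (hinj ⟨ht.1, ht.2.trans hc.2⟩ hc (hta.trans hca.symm))
  · push Not at hc
    exact key b ⟨hab, le_rfl⟩ h hc

end

theorem mainTheorem9 {X : Type*} [MetricSpace X] (hX : IsDendrite X) (f : X → X)
    (hf : Continuous f) (hsurj : Function.Surjective f)
    (hdense : Dense (Function.periodicPts f))
    (hconn : IsConnected (Function.periodicPts f)) :
    IsHomeomorph f := by
  have := hX.continuum.compact
  have := hX.continuum.connected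
  have := hX.locallyConnected
  have : LocallyPathConnectedSpace X := LocallyConnectedSpace.locallyPathConnectedSpace
  have : PathConnectedSpace X := pathConnectedSpace_iff_connectedSpace.2 inferInstance
  refine isHomeomorph_iff_continuous_bijective.2 ⟨hf, fun x y hxy => ?_, hsurj⟩
  by_contra hne
  obtain ⟨α, hα, hαi, h0, h1, -⟩ :=
    (joinedIn_univ.2 (PathConnectedSpace.joined x y)).exists_arc hne
  -- The ends `x`, `y` need not be periodic, so injectivity is available on the open interval only.
  refine ne_endpoints_of_injOn_Ioo hX.no_simpleClosedCurve zero_lt_one (hf.comp_continuousOn hα)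
    ((Function.bijOn_periodicPts f).injOn.comp (hαi.mono Ioo_subset_Icc_self) fun t ht =>
      arc_mem_of_dense_isPreconnected hX.no_simpleClosedCurve hdense hconn.isPreconnected hα hαi ht)
    (by simpa [h0, h1] using hxy)
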